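/- Let $\Theta$ be a Borel subset of a Polish space, $\mathcal T$ its Borel $\sigma$-field, $Q$ a probability measure (the prior) on $(\Theta,\mathcal T)$, and $\{P_\theta\colon\theta\in\Theta\}$ a family of probability measures on a measurable space $(\Omega,\mathcal A)$. Let $(\Omega_1,\mathcal A_1)$ be a standard Borel space and let $X_1:\Omega\to\Omega_1$ and $X_2:\Omega\to\mathbb R$ be measurable. Write $R_\theta$ for the distribution of $(X_1,X_2)$ under $P_\theta$. Suppose that $\theta\mapsto R_\theta$ is a Markov kernel, that $\{R_\theta\}$ is identifiable (i.e. $\theta\mapsto R_\theta$ is injective), and that $\int_\Theta E_\theta(X_2^2)\,dQ(\theta)<\infty$. For $m\in\mathbb N$ or $m=\mathbb N$ let $R_\theta^m$ be the $m$-fold product of $R_\theta$, and let $\Pi_m$ be the probability measure on $(\Omega_1\times\mathbb R)^m\times(\Omega_1\times\mathbb R)\times\Theta$ with $\Pi_m(A'\times A\times T)=\int_T R_\theta(A)R^m_\theta(A')\,dQ(\theta)$; its generic point is $(x',x,\theta)$ with $x=(x_1,x_2)$, and for $m=\mathbb N$ we write $x'_{(n)}=(x'_1,\dots,x'_n)$.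 For $n\in\mathbb N$ let $\beta_n=\int_\Theta R^n_\theta\,dQ(\theta)$ be the prior predictive distribution, let $R^*_{n,x'}$ be the posterior distribution, i.e. a Markov kernel with $\int_T R^n_\theta(A')\,dQ(\theta)=\int_{A'}R^*_{n,x'}(T)\,d\beta_n(x')$ for all measurable $A',T$, and let $R^{*R}_{n,x'}(A)=\int_\Theta R_\theta(A)\,dR^*_{n,x'}(\theta)$ be the posterior predictive distribution. Let $p_1,p_2$ be the coordinate maps of $\Omega_1\times\mathbb R$. Let $r_\theta(x_1)=E_\theta(X_2\mid X_1=x_1)$ (for $Q$-almost every $\theta$) and $m_n^*(x',x_1)=E_{R^{*R}_{n,x'}}(p_2\mid p_1=x_1)$ (for $\beta_n$-almost every $x'$) be the sampling and the posterior predictive regression curves, taken measurable in $(\theta,x_1)$ and in $(x',x_1)$ respectively. Then posterior distributions and such regression curves exist, and for all versions of them: (i) $m_n^*$ is the Bayes estimator of the regression curve $r_\theta$ for the squared error loss: for every $n$, $$E_{\Pi_n}\big[(m_n^*(x',x_1)-r_\theta(x_1))^2\big]\le E_{\Pi_n}\big[(m_n(x',x_1)-r_\theta(x_1))^2\big]$$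 for every estimator (measurable function) $m_n:(\Omega_1\times\mathbb R)^n\times\Omega_1\to\mathbb R$. (ii) $m_n^*$ is strongly consistent: $\lim_n m_n^*(x'_{(n)},x_1)=r_\theta(x_1)$ for $\Pi_{\mathbb N}$-almost every $(x',x,\theta)$. (iii) The Bayes risk converges to $0$: $\lim_n E_{\Pi_{\mathbb N}}\big[|m_n^*(x'_{(n)},x_1)-r_\theta(x_1)|^k\big]=0$ for $k=1,2$. -/

import Mathlib

open MeasureTheory ProbabilityTheory Filter Topology
open scoped ENNReal

namespace BayesRegression

/-- `r` is a version of the regression curve `x₁ ↦ E_μ(Y | X = x₁)` of the integrable real random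
variable `Y` given the random variable `X`: a measurable function on the value space of `X` such
that `r ∘ X` is a version of the conditional expectation of `Y` given the σ-algebra of `X`. -/
structure IsRegressionCurve {Ω Ω₁ : Type*} [MeasurableSpace Ω] [m₁ : MeasurableSpace Ω₁]
    (μ : Measure Ω) (X : Ω → Ω₁) (Y : Ω → ℝ) (r : Ω₁ → ℝ) : Prop where
  measurable : Measurable r
  integrable : Integrable Y μ
  ae_eq_condExp : (fun ω => r (X ω)) =ᵐ[μ] μ[Y | m₁.comap X]

theorem measurable_infinitePi {Θ E : Type*} [MeasurableSpace Θ] [MeasurableSpace E] (ι : Type*)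
    (R : Kernel Θ E) [IsMarkovKernel R] :
    Measurable fun θ => Measure.infinitePi (fun _ : ι => R θ) := by
  refine Measurable.measure_of_isPiSystem_of_isProbabilityMeasure
    generateFrom_squareCylinders.symm
    (isPiSystem_squareCylinders (fun _ => MeasurableSpace.isPiSystem_measurableSet) (by simp)) ?_
  rintro _ ⟨s, t, ht, rfl⟩
  have ht' : ∀ i, MeasurableSet (t i) := fun i => ht i (Set.mem_univ i)
  simp_rw [Measure.infinitePi_pi (fun _ : ι => R _) (fun i _ => ht' i)]
  exact Finset.measurable_prod _ fun i _ => R.measurable_coe (ht' i)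

/-- The sampling kernel `θ ↦ R_θ^ι`: the law of an i.i.d. family indexed by `ι` with common
distribution `R_θ` (`ι = Fin n` for a sample of size `n`, `ι = ℕ` for an infinite sample). -/
noncomputable def sampleKernel {Θ E : Type*} [MeasurableSpace Θ] [MeasurableSpace E] (ι : Type*)
    (R : Kernel Θ E) [IsMarkovKernel R] : Kernel Θ (ι → E) where
  toFun θ := Measure.infinitePi fun _ : ι => R θ
  measurable' := measurable_infinitePi ι R

instance {Θ E : Type*} [MeasurableSpace Θ] [MeasurableSpace E] (ι : Type*)
    (R : Kernel Θ E) [IsMarkovKernel R] : IsMarkovKernel (sampleKernel ι R) :=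
  ⟨fun θ => inferInstanceAs (IsProbabilityMeasure (Measure.infinitePi fun _ : ι => R θ))⟩

/-- The joint law `Π_ι` of (sample, new observation, parameter) on `(ι → E) × E × Θ`:
the parameter has law `Q` and, given that it equals `θ`, the sample and the new observation are
independent with laws `R_θ^ι` and `R_θ`, so that
`Π_ι (A' × A × T) = ∫_T R_θ(A) R_θ^ι(A') dQ(θ)`. -/
noncomputable def jointLaw {Θ E : Type*} [MeasurableSpace Θ] [MeasurableSpace E] (ι : Type*)
    (Q : Measure Θ) (R : Kernel Θ E) [IsMarkovKernel R] : Measure ((ι → E) × E × Θ) :=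
  Q.bind (sampleKernel ι R ×ₖ (R ×ₖ Kernel.id))

/-- `post` is a version of the posterior distribution for the prior `Q` and the sampling kernel `K`:
a Markov kernel such that
`∫_T K_θ(A) dQ(θ) = ∫_A post_x(T) dβ(x)` for all measurable `A` and `T`, where `β = ∫ K_θ dQ(θ)` is
the prior predictive distribution. -/
structure IsPosterior {Θ F : Type*} [MeasurableSpace Θ] [MeasurableSpace F]
    (Q : Measure Θ) (K : Kernel Θ F) (post : Kernel F Θ) : Prop where
  isMarkovKernel : IsMarkovKernel post
  setLIntegral_eq : ∀ (A : Set F) (T : Set Θ), MeasurableSet A → MeasurableSet T →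
    ∫⁻ θ in T, K θ A ∂Q = ∫⁻ x in A, post x T ∂(Q.bind K)

/-- `m` is a version of the regression curve of the posterior predictive distribution,
`m (x', x₁) = E(p₂ | p₁ = x₁)`, the expectation being taken under
`A ↦ ∫ R_θ(A) d post_{x'}(θ)`: it is jointly measurable and, for almost every sample `x'` with
respect to the prior predictive distribution, `m (x', ·)` is a regression curve of the second
coordinate given the first one under the posterior predictive distribution at `x'`. -/
structure IsPredictiveRegressionCurve {Θ Ω₁ : Type*} [MeasurableSpace Θ] [MeasurableSpace Ω₁]
    {n : ℕ} (Q : Measure Θ) (R : Kernel Θ (Ω₁ × ℝ)) [IsMarkovKernel R]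
    (post : Kernel (Fin n → Ω₁ × ℝ) Θ) (m : (Fin n → Ω₁ × ℝ) × Ω₁ → ℝ) : Prop where
  measurable : Measurable m
  ae_isRegressionCurve : ∀ᵐ x' ∂(Q.bind (sampleKernel (Fin n) R)),
    IsRegressionCurve ((post x').bind R) Prod.fst Prod.snd (fun x₁ => m (x', x₁))

/-- `r` is a version of the family of sampling regression curves
`r (θ, x₁) = E_θ(X₂ | X₁ = x₁)`: it is jointly measurable and, for `Q`-almost every `θ`, `r (θ, ·)`
is a regression curve of `X₂` given `X₁` under `P_θ`. -/
structure IsSamplingRegressionCurve {Θ Ω Ω₁ : Type*} [MeasurableSpace Θ] [MeasurableSpace Ω]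
    [MeasurableSpace Ω₁] (Q : Measure Θ) (P : Θ → Measure Ω) (X₁ : Ω → Ω₁) (X₂ : Ω → ℝ)
    (r : Θ × Ω₁ → ℝ) : Prop where
  measurable : Measurable r
  ae_isRegressionCurve : ∀ᵐ θ ∂Q, IsRegressionCurve (P θ) X₁ X₂ (fun x₁ => r (θ, x₁))

end BayesRegression

/-! Everything takes place under the joint law of sample `x'`, new observation `(x₁, x₂)` and
parameter `θ`. Given `θ`, the new observation is independent of `x'`, so `r_θ(x₁)` is the
conditional mean of `x₂` given `(x', θ, x₁)` (`isRegressionCurve_jointLaw_sampling`). Given `x'`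
alone, its law is the posterior predictive one, so `m_n*` is the conditional mean of `x₂` given
`(x', x₁)` (`isRegressionCurve_jointLaw_predictive`). By the tower property `m_n*` is the
conditional expectation of `r_θ(x₁)` given `(x', x₁)`. Claim (i) is then the projection property of
conditional expectation (`IsRegressionCurve.lintegral_sq_sub_le`).

For (ii), embed all sample sizes in one infinite sample: the `m_n*` become a martingale closed by
`r_θ(x₁)`, and Lévy's upward theorem gives convergence to the conditional expectation given all of
`x'` and `x₁`. As in Doob's consistency theorem, this limit is `r_θ(x₁)` itself, because
identifiability makes `θ` almost surely a Borel function of `x'`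
(`exists_measurable_sampleKernel_ae_eq`).

For (iii), `m_n*` does at least as well as its truncations, whose risks are controlled by dominated
convergence (`tendsto_lintegral_sq_sub_of_isRegressionCurve`). -/

namespace BayesRegression

/-! ### Regression curves: characterisation, transfer and optimality -/

section RegressionCurve

variable {Z A Ω₁ : Type*} [MeasurableSpace Z] [MeasurableSpace A] [MeasurableSpace Ω₁]
  {μ : Measure Z} {X : Z → Ω₁} {Y : Z → ℝ} {r : Ω₁ → ℝ}

theorem IsRegressionCurve.integrable_comp (h : IsRegressionCurve μ X Y r) :
    Integrable (fun z => r (X z)) μ :=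
  integrable_condExp.congr h.ae_eq_condExp.symm

theorem IsRegressionCurve.memLp_two (h : IsRegressionCurve μ X Y r) (hY : MemLp Y 2 μ) :
    MemLp (fun z => r (X z)) 2 μ :=
  (memLp_congr_ae h.ae_eq_condExp).2 (hY.condExp (by norm_num))

variable [IsFiniteMeasure μ]

theorem IsRegressionCurve.setIntegral_eq (h : IsRegressionCurve μ X Y r) (hX : Measurable X)
    {B : Set Ω₁} (hB : MeasurableSet B) :
    ∫ z in X ⁻¹' B, r (X z) ∂μ = ∫ z in X ⁻¹' B, Y z ∂μ := by
  rw [setIntegral_congr_ae (g := μ[Y | MeasurableSpace.comap X inferInstance]) (hX hB)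
    (h.ae_eq_condExp.mono fun z hz _ => hz)]
  exact setIntegral_condExp hX.comap_le h.integrable ⟨B, hB, rfl⟩

/-- The transfer results below are all verified through this criterion, since integrals over the
sets `X ⁻¹' B` push forward and disintegrate. -/
theorem IsRegressionCurve.of_setIntegral_eq (hX : Measurable X) (hr : Measurable r)
    (hY : Integrable Y μ) (hrX : Integrable (fun z => r (X z)) μ)
    (h : ∀ B, MeasurableSet B → ∫ z in X ⁻¹' B, r (X z) ∂μ = ∫ z in X ⁻¹' B, Y z ∂μ) :
    IsRegressionCurve μ X Y r where
  measurable := hr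
  integrable := hY
  ae_eq_condExp := by
    refine ae_eq_condExp_of_forall_setIntegral_eq hX.comap_le hY
      (fun _ _ _ => hrX.integrableOn) ?_ ?_
    · rintro _ ⟨B, hB, rfl⟩ _
      exact h B hB
    · exact (hr.comp (comap_measurable X)).stronglyMeasurable.aestronglyMeasurable

/-- A regression curve of `Y` given `X` only depends on the joint law of `(X, Y)`. -/
theorem isRegressionCurve_map_iff {W : Type*} [MeasurableSpace W] {T : W → Z} {ν : Measure W}
    [IsFiniteMeasure ν] (hT : Measurable T) (hX : Measurable X) (hY : Measurable Y) :
    IsRegressionCurve (ν.map T) X Y r ↔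
      IsRegressionCurve ν (fun w => X (T w)) (fun w => Y (T w)) r := by
  have hset : ∀ {f : Z → ℝ}, Measurable f → ∀ {B}, MeasurableSet B →
      ∫ z in X ⁻¹' B, f z ∂(ν.map T) = ∫ w in (fun w => X (T w)) ⁻¹' B, f (T w) ∂ν :=
    fun hf _ hB => setIntegral_map (hX hB) hf.aestronglyMeasurable hT.aemeasurable
  constructor
  · intro h
    refine .of_setIntegral_eq (hX.comp hT) h.measurable (h.integrable.comp_measurable hT)
      (h.integrable_comp.comp_measurable hT) fun B hB => ?_
    rw [← hset (f := fun z => r (X z)) (h.measurable.comp hX) hB, ← hset hY hB,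
      h.setIntegral_eq hX hB]
  · intro h
    have hrX : Measurable fun z => r (X z) := h.measurable.comp hX
    refine .of_setIntegral_eq hX h.measurable
      ((integrable_map_measure hY.aestronglyMeasurable hT.aemeasurable).2 h.integrable)
      ((integrable_map_measure hrX.aestronglyMeasurable hT.aemeasurable).2 h.integrable_comp)
      fun B hB => ?_
    rw [hset hrX hB, hset hY hB, h.setIntegral_eq (hX.comp hT) hB]

/-- The tower property: if `X` is a function of `X'`, then a regression curve of `Y` given `X` is a
regression curve given `X` of the conditional expectation of `Y` given `X'`. -/
theorem IsRegressionCurve.tower {Ω₂ : Type*} [MeasurableSpace Ω₂] {X' : Z → Ω₂} {r' : Ω₂ → ℝ}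
    {g : Ω₂ → Ω₁} (h : IsRegressionCurve μ X Y r) (h' : IsRegressionCurve μ X' Y r')
    (hX : Measurable X) (hX' : Measurable X') (hg : Measurable g) (hgX : ∀ z, X z = g (X' z)) :
    IsRegressionCurve μ X (fun z => r' (X' z)) r := by
  refine .of_setIntegral_eq hX h.measurable h'.integrable_comp h.integrable_comp fun B hB => ?_
  have : X ⁻¹' B = X' ⁻¹' (g ⁻¹' B) := by ext z; simp [hgX]
  rw [h.setIntegral_eq hX hB, this, h'.setIntegral_eq hX' (hg hB)]

/-- Regression curves of the fibres of a mixture form a regression curve of the mixture. -/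
theorem IsRegressionCurve.compProd {β : Measure A} [IsFiniteMeasure β] {K : Kernel A (Ω₁ × ℝ)}
    [IsMarkovKernel K] {f : A × Ω₁ → ℝ} (hf : Measurable f)
    (hint : Integrable (fun z : A × Ω₁ × ℝ => z.2.2) (β ⊗ₘ K))
    (h : ∀ᵐ a ∂β, IsRegressionCurve (K a) Prod.fst Prod.snd fun x₁ => f (a, x₁)) :
    IsRegressionCurve (β ⊗ₘ K) (fun z => (z.1, z.2.1)) (fun z => z.2.2) f := by
  have hX : Measurable fun z : A × Ω₁ × ℝ => (z.1, z.2.1) := by fun_prop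
  have hY : Measurable fun z : A × Ω₁ × ℝ => z.2.2 := by fun_prop
  have hfX : Measurable fun z : A × Ω₁ × ℝ => f (z.1, z.2.1) := hf.comp hX
  -- Conditional expectation contracts the `L¹` norm on each fibre; integrating over `β` gives the
  -- bound.
  have hfint : Integrable (fun z : A × Ω₁ × ℝ => f (z.1, z.2.1)) (β ⊗ₘ K) := by
    refine ⟨hfX.aestronglyMeasurable, lt_of_le_of_lt ?_ hint.2⟩
    change ∫⁻ _, _ ∂_ ≤ ∫⁻ _, _ ∂_
    rw [Measure.lintegral_compProd hfX.enorm, Measure.lintegral_compProd hY.enorm]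
    refine lintegral_mono_ae (h.mono fun a ha => ?_)
    have := eLpNorm_condExp_le_eLpNorm (μ := K a) (m := MeasurableSpace.comap Prod.fst inferInstance)
      (Prod.snd : Ω₁ × ℝ → ℝ) (le_refl 1)
    rw [← eLpNorm_congr_ae ha.ae_eq_condExp] at this
    simpa [eLpNorm_one_eq_lintegral_enorm] using this
  refine .of_setIntegral_eq hX hf hint hfint fun B hB => ?_
  have key : ∀ {g : A × Ω₁ × ℝ → ℝ}, Integrable g (β ⊗ₘ K) →
      ∫ z in (fun z : A × Ω₁ × ℝ => (z.1, z.2.1)) ⁻¹' B, g z ∂(β ⊗ₘ K) =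
        ∫ a, ∫ y in Prod.fst ⁻¹' (Prod.mk a ⁻¹' B), g (a, y) ∂(K a) ∂β := by
    intro g hg
    rw [← integral_indicator (hX hB), Measure.integral_compProd (hg.indicator (hX hB))]
    refine integral_congr_ae (.of_forall fun a => ?_)
    dsimp only
    rw [← integral_indicator (measurable_fst (measurable_prodMk_left hB))]
    rfl
  rw [key hfint, key hint]
  exact integral_congr_ae (h.mono fun a ha =>
    ha.setIntegral_eq measurable_fst (measurable_prodMk_left hB))

/-- The conditional mean of the second coordinate is a regression curve. -/
theorem isRegressionCurve_condKernel [StandardBorelSpace Ω₁] (K : Kernel A (Ω₁ × ℝ))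
    [IsMarkovKernel K] [MeasurableSpace.CountableOrCountablyGenerated A Ω₁] {a : A}
    (ha : Integrable Prod.snd (K a)) :
    IsRegressionCurve (K a) Prod.fst Prod.snd fun x₁ => ∫ y, y ∂(K.condKernel (a, x₁)) := by
  have hm : Measurable fun x₁ => ∫ y, y ∂(K.condKernel (a, x₁)) :=
    (measurable_snd.stronglyMeasurable.integral_kernel_prod_right'
      (κ := K.condKernel) (f := fun p : (A × Ω₁) × ℝ => p.2)).measurable.comp measurable_prodMk_left
  have ha' := ha
  rw [← K.disintegrate K.condKernel] at ha'
  have hi := ha'.integral_compProd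
  have hfst : K.fst a = (K a).map Prod.fst := Kernel.fst_apply K a
  have hi' : Integrable (fun z : Ω₁ × ℝ => ∫ y, y ∂(K.condKernel (a, z.1))) (K a) := by
    rw [hfst] at hi
    exact hi.comp_measurable measurable_fst
  refine .of_setIntegral_eq measurable_fst hm ha hi' fun B hB => ?_
  have := setIntegral_condKernel_univ_right (κ := K) a (f := Prod.snd) hB ha.integrableOn
  rw [Set.prod_univ] at this
  rw [← this, hfst, setIntegral_map hB hm.aestronglyMeasurable measurable_fst.aemeasurable]

/-- A regression curve is the least squares predictor. -/
theorem IsRegressionCurve.lintegral_sq_sub_le (h : IsRegressionCurve μ X Y r) (hX : Measurable X)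
    (hYm : Measurable Y) (hY : MemLp Y 2 μ) {g : Ω₁ → ℝ} (hg : Measurable g) :
    ∫⁻ z, ENNReal.ofReal ((r (X z) - Y z) ^ 2) ∂μ ≤
      ∫⁻ z, ENNReal.ofReal ((g (X z) - Y z) ^ 2) ∂μ := by
  -- If the risk of `g` is finite, then `g ∘ X - Y` and hence `g ∘ X - r ∘ X` lie in `L²`, which
  -- makes the cross term integrable.
  by_cases htop : ∫⁻ z, ENNReal.ofReal ((g (X z) - Y z) ^ 2) ∂μ = ∞
  · simp [htop]
  have hgX : Measurable fun z => g (X z) := hg.comp hX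
  have hrX : Measurable fun z => r (X z) := h.measurable.comp hX
  have hr2 := h.memLp_two hY
  have hd2 : MemLp (fun z => g (X z) - Y z) 2 μ := by
    refine (memLp_two_iff_integrable_sq (hgX.sub hYm).aestronglyMeasurable).2
      ⟨((hgX.sub hYm).pow_const 2).aestronglyMeasurable, ?_⟩
    rw [hasFiniteIntegral_iff_ofReal (.of_forall fun z => sq_nonneg _)]
    exact lt_top_iff_ne_top.2 htop
  have hgr : MemLp (fun z => g (X z) - r (X z)) 2 μ := by
    have := (hd2.add hY).sub hr2
    convert this using 2 with z
    simp
  have hry : MemLp (fun z => r (X z) - Y z) 2 μ := hr2.sub hY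
  have hprod : Integrable (fun z => (g (X z) - r (X z)) * (r (X z) - Y z)) μ :=
    hgr.integrable_mul hry
  -- The first factor is measurable for the σ-algebra of `X` and pulls out of the conditional
  -- expectation; the second has conditional expectation zero.
  have horth : ∫ z, (g (X z) - r (X z)) * (r (X z) - Y z) ∂μ = 0 := by
    have hmeas : StronglyMeasurable[MeasurableSpace.comap X inferInstance]
        fun z => g (X z) - r (X z) :=
      ((hg.sub h.measurable).comp (comap_measurable X)).stronglyMeasurable
    have hpull := condExp_mul_of_stronglyMeasurable_left hmeas hprod
      (hry.integrable one_le_two)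
    have hzero : μ[fun z => r (X z) - Y z | MeasurableSpace.comap X inferInstance] =ᵐ[μ] 0 := by
      have h1 := condExp_sub h.integrable_comp h.integrable
        (MeasurableSpace.comap X inferInstance)
      have h2 := condExp_of_stronglyMeasurable hX.comap_le
        ((h.measurable.comp (comap_measurable X)).stronglyMeasurable) h.integrable_comp
      filter_upwards [h1, h.ae_eq_condExp] with z hz1 hz2
      change μ[(fun z => r (X z)) - Y | _] z = 0
      rw [hz1, Pi.sub_apply, ← hz2]
      exact sub_eq_zero.2 (congrFun h2 z)
    rw [← integral_condExp hX.comap_le]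
    refine integral_eq_zero_of_ae ?_
    filter_upwards [hpull, hzero] with z hz1 hz2
    refine hz1.trans ?_
    simp [hz2]
  rw [← ofReal_integral_eq_lintegral_ofReal hry.integrable_sq (.of_forall fun z => sq_nonneg _),
    ← ofReal_integral_eq_lintegral_ofReal hd2.integrable_sq (.of_forall fun z => sq_nonneg _)]
  refine ENNReal.ofReal_le_ofReal ?_
  have hexp : ∫ z, (g (X z) - Y z) ^ 2 ∂μ = ∫ z, (g (X z) - r (X z)) ^ 2 ∂μ +
      2 * ∫ z, (g (X z) - r (X z)) * (r (X z) - Y z) ∂μ + ∫ z, (r (X z) - Y z) ^ 2 ∂μ := by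
    rw [← integral_const_mul, ← integral_add hgr.integrable_sq (hprod.const_mul 2),
      ← integral_add (by exact hgr.integrable_sq.add (hprod.const_mul 2)) hry.integrable_sq]
    exact integral_congr_ae (.of_forall fun z => by ring)
  rw [hexp, horth]
  have : 0 ≤ ∫ z, (g (X z) - r (X z)) ^ 2 ∂μ := integral_nonneg fun z => sq_nonneg _
  linarith

end RegressionCurve

end BayesRegression
namespace BayesRegression

/-! ### The joint law, its marginals and the posterior -/

section JointLaw

variable {Θ E : Type*} [MeasurableSpace Θ] [MeasurableSpace E] {ι : Type*} {Q : Measure Θ}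
  {R : Kernel Θ E} [IsMarkovKernel R]

instance [IsProbabilityMeasure Q] : IsProbabilityMeasure (jointLaw ι Q R) :=
  inferInstanceAs (IsProbabilityMeasure (Q.bind (sampleKernel ι R ×ₖ (R ×ₖ Kernel.id))))

theorem lintegral_jointLaw {f : (ι → E) × E × Θ → ℝ≥0∞} (hf : Measurable f) :
    ∫⁻ z, f z ∂(jointLaw ι Q R) =
      ∫⁻ θ, ∫⁻ x', ∫⁻ x, f (x', x, θ) ∂(R θ) ∂(sampleKernel ι R θ) ∂Q := by
  rw [jointLaw, Measure.lintegral_bind (Kernel.aemeasurable _) hf.aemeasurable]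
  refine lintegral_congr fun θ => ?_
  rw [Kernel.prod_apply, lintegral_prod _ hf.aemeasurable]
  refine lintegral_congr fun x' => ?_
  rw [Kernel.prod_apply, lintegral_prod _ (by fun_prop)]
  refine lintegral_congr fun x => ?_
  rw [Kernel.id_apply, lintegral_dirac' _ (by fun_prop)]

theorem jointLaw_map_param_sample [IsProbabilityMeasure Q] :
    (jointLaw ι Q R).map (fun z => (z.2.2, z.1)) = Q ⊗ₘ sampleKernel ι R := by
  refine Measure.ext_of_lintegral _ fun f hf => ?_
  rw [lintegral_map hf (by fun_prop), lintegral_jointLaw (by fun_prop),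
    Measure.lintegral_compProd hf]
  simp

theorem jointLaw_map_param_obs [IsProbabilityMeasure Q] :
    (jointLaw ι Q R).map (fun z => (z.2.2, z.2.1)) = Q ⊗ₘ R := by
  refine Measure.ext_of_lintegral _ fun f hf => ?_
  rw [lintegral_map hf (by fun_prop), lintegral_jointLaw (by fun_prop),
    Measure.lintegral_compProd hf]
  simp

theorem jointLaw_map_sample_param_obs [IsProbabilityMeasure Q] :
    (jointLaw ι Q R).map (fun z => ((z.1, z.2.2), z.2.1)) =
      (Q ⊗ₘ sampleKernel ι R).map Prod.swap ⊗ₘ R.comap Prod.snd measurable_snd := by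
  have : IsProbabilityMeasure ((Q ⊗ₘ sampleKernel ι R).map Prod.swap) :=
    Measure.isProbabilityMeasure_map measurable_swap.aemeasurable
  refine Measure.ext_of_lintegral _ fun f hf => ?_
  have hg : Measurable fun p : (ι → E) × Θ =>
      ∫⁻ x, f (p, x) ∂(R.comap Prod.snd measurable_snd p) := hf.lintegral_kernel_prod_right'
  rw [lintegral_map hf (by fun_prop), lintegral_jointLaw (by fun_prop),
    Measure.lintegral_compProd hf, lintegral_map hg measurable_swap]
  exact (Measure.lintegral_compProd (μ := Q) (κ := sampleKernel ι R)
    (hg.comp measurable_swap)).symm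

/-- The defining identity is this equality on measurable rectangles, which determine a finite
measure. -/
theorem IsPosterior.compProd_eq {F : Type*} [MeasurableSpace F] [IsProbabilityMeasure Q]
    {K : Kernel Θ F} [IsMarkovKernel K] {post : Kernel F Θ} (h : IsPosterior Q K post) :
    Q.bind K ⊗ₘ post = (Q ⊗ₘ K).map Prod.swap := by
  have := h.isMarkovKernel
  refine Measure.ext_prod fun {A T} hA hT => ?_
  rw [Measure.map_apply measurable_swap (hA.prod hT), Set.preimage_swap_prod,
    Measure.compProd_apply_prod hA hT, Measure.compProd_apply_prod hT hA,
    h.setLIntegral_eq A T hA hT]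

theorem isPosterior_posterior {F : Type*} [MeasurableSpace F] [StandardBorelSpace Θ] [Nonempty Θ]
    [IsProbabilityMeasure Q] (K : Kernel Θ F) [IsMarkovKernel K] :
    IsPosterior Q K (posterior K Q) where
  isMarkovKernel := inferInstance
  setLIntegral_eq A T hA hT := by
    have h := congrArg (fun ν => ν (A ×ˢ T)) (compProd_posterior_eq_map_swap (κ := K) (μ := Q))
    rw [Measure.map_apply measurable_swap (hA.prod hT), Set.preimage_swap_prod,
      Measure.compProd_apply_prod hA hT, Measure.compProd_apply_prod hT hA] at h
    exact h.symm

theorem jointLaw_map_sample_obs [IsProbabilityMeasure Q] {post : Kernel (ι → E) Θ}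
    [IsMarkovKernel post] (h : IsPosterior Q (sampleKernel ι R) post) :
    (jointLaw ι Q R).map (fun z => (z.1, z.2.1)) = Q.bind (sampleKernel ι R) ⊗ₘ (R ∘ₖ post) := by
  refine Measure.ext_of_lintegral _ fun f hf => ?_
  have hg : Measurable fun p : (ι → E) × Θ => ∫⁻ x, f (p.1, x) ∂(R p.2) := by
    have : Measurable fun q : ((ι → E) × Θ) × E => f (q.1.1, q.2) := by fun_prop
    exact this.lintegral_kernel_prod_right' (κ := R.comap Prod.snd measurable_snd)
  rw [lintegral_map hf (by fun_prop), lintegral_jointLaw (by fun_prop),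
    Measure.lintegral_compProd hf]
  have hswap := Measure.lintegral_compProd (μ := Q) (κ := sampleKernel ι R)
    (hg.comp measurable_swap)
  simp only [Function.comp_def] at hswap
  rw [← lintegral_map hg measurable_swap, ← h.compProd_eq, Measure.lintegral_compProd hg] at hswap
  refine hswap.symm.trans (lintegral_congr fun x' => ?_)
  rw [Kernel.lintegral_comp _ _ _ (by fun_prop)]

theorem sampleKernel_map_precomp {κ : Type*} {e : κ → ι} (he : Function.Injective e) (θ : Θ) :
    (sampleKernel ι R θ).map (fun x k => x (e k)) = sampleKernel κ R θ :=
  Measure.map_infinitePi_infinitePi_of_inj he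

/-- With `e` the inclusion of `Fin n` into `ℕ`, this carries statements about samples of size `n` to
a single infinite sample. -/
theorem jointLaw_map_precomp [IsProbabilityMeasure Q] {κ : Type*} {e : κ → ι}
    (he : Function.Injective e) :
    (jointLaw ι Q R).map (fun z => (fun k => z.1 (e k), z.2)) = jointLaw κ Q R := by
  refine Measure.ext_of_lintegral _ fun f hf => ?_
  rw [lintegral_map hf (by fun_prop), lintegral_jointLaw (by fun_prop), lintegral_jointLaw hf]
  refine lintegral_congr fun θ => ?_
  have hg : Measurable fun x' => ∫⁻ x, f (x', x, θ) ∂(R θ) := by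
    have : Measurable fun q : (κ → E) × E => f (q.1, q.2, θ) := by fun_prop
    exact this.lintegral_prod_right'
  rw [← sampleKernel_map_precomp he, lintegral_map hg (by fun_prop)]

end JointLaw

end BayesRegression
namespace BayesRegression

/-! ### Martingale convergence and mean square convergence -/

section Convergence

variable {Z : Type*} [MeasurableSpace Z] {μ : Measure Z} [IsProbabilityMeasure μ]
  {F : ℕ → Type*} [∀ n, MeasurableSpace (F n)] {X : ∀ n, Z → F n} {V : Z → ℝ} {m : ∀ n, F n → ℝ}

/-- Regression curves given increasingly fine statistics converge almost surely to the response if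
it is almost surely determined by the statistics. -/
theorem tendsto_ae_of_isRegressionCurve (hX : ∀ n, Measurable (X n))
    (hmono : Monotone fun n => (inferInstance : MeasurableSpace (F n)).comap (X n))
    (h : ∀ n, IsRegressionCurve μ (X n) V (m n)) {W : Z → ℝ}
    (hW : StronglyMeasurable[⨆ n, (inferInstance : MeasurableSpace (F n)).comap (X n)] W)
    (hWV : W =ᵐ[μ] V) :
    ∀ᵐ z ∂μ, Tendsto (fun n => m n (X n z)) atTop (𝓝 (V z)) := by
  let ℱ : Filtration ℕ (inferInstance : MeasurableSpace Z) :=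
    { seq := fun n => (inferInstance : MeasurableSpace (F n)).comap (X n)
      mono' := hmono
      le' := fun n => (hX n).comap_le }
  -- Lévy's upward theorem is applied to `W`, since `V` itself need not be measurable for the
  -- limiting σ-algebra.
  have hlim : ∀ᵐ z ∂μ, Tendsto (fun n => (μ[W | ℱ n]) z) atTop (𝓝 (W z)) :=
    ((h 0).integrable.congr hWV.symm).tendsto_ae_condExp hW
  have heq : ∀ᵐ z ∂μ, ∀ n, m n (X n z) = (μ[W | ℱ n]) z :=
    ae_all_iff.2 fun n => (h n).ae_eq_condExp.trans (condExp_congr_ae hWV.symm)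
  filter_upwards [hlim, heq, hWV] with z h1 h2 h3
  simpa only [h2, ← h3] using h1

/-- Clipping at level `c ≥ 0` moves `y` towards zero and never past it. This dominates the
truncation error uniformly in `c`. -/
theorem abs_max_min_sub_le {c y : ℝ} (hc : 0 ≤ c) : |max (-c) (min c y) - y| ≤ |y| := by
  rcases le_total c y with h | h <;> rcases le_total (-c) y with h' | h' <;>
    rcases abs_cases y with h1 | h1 <;> simp [h, h', abs_le] <;> grind

/-- The mean squared errors of regression curves that converge almost surely to a square
integrable response tend to zero. -/
theorem tendsto_lintegral_sq_sub_of_isRegressionCurve (hX : ∀ n, Measurable (X n))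
    (h : ∀ n, IsRegressionCurve μ (X n) V (m n)) (hVm : Measurable V) (hV : MemLp V 2 μ)
    (hlim : ∀ᵐ z ∂μ, Tendsto (fun n => m n (X n z)) atTop (𝓝 (V z))) :
    Tendsto (fun n => ∫⁻ z, ENNReal.ofReal ((m n (X n z) - V z) ^ 2) ∂μ) atTop (𝓝 0) := by
  have hclip : ∀ c : ℝ, Continuous fun y : ℝ => max (-c) (min c y) := fun c => by fun_prop
  have hfin : ∀ c : ℝ, ∫⁻ z, ENNReal.ofReal ((c + |V z|) ^ 2) ∂μ ≠ ∞ := fun c => by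
    have := (((memLp_const c).add hV.norm).integrable_sq).lintegral_lt_top
    exact this.ne
  have hconst : Tendsto (fun c : ℕ =>
      ∫⁻ z, ENNReal.ofReal ((max (-(c : ℝ)) (min c (V z)) - V z) ^ 2) ∂μ) atTop (𝓝 0) := by
    have := tendsto_lintegral_of_dominated_convergence (μ := μ)
      (F := fun (c : ℕ) z => ENNReal.ofReal ((max (-(c : ℝ)) (min c (V z)) - V z) ^ 2))
      (f := fun _ => 0) (fun z => ENNReal.ofReal ((0 + |V z|) ^ 2))
      (fun c => by fun_prop) (fun c => .of_forall fun z => ?_) (hfin 0) (.of_forall fun z => ?_)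
    · simpa using this
    · refine ENNReal.ofReal_le_ofReal ?_
      rw [zero_add, ← sq_abs]
      exact pow_le_pow_left₀ (abs_nonneg _) (abs_max_min_sub_le c.cast_nonneg) 2
    · obtain ⟨N, hN⟩ := exists_nat_ge |V z|
      refine tendsto_const_nhds.congr' ?_
      filter_upwards [eventually_ge_atTop N] with c hc
      have h1 : |V z| ≤ c := hN.trans (by exact_mod_cast hc)
      rw [abs_le] at h1
      simp [min_eq_right h1.2, max_eq_right h1.1]
  rw [ENNReal.tendsto_nhds_zero]
  intro ε hε
  -- The level `c` is fixed before `n` varies: the clipped curves are bounded by `c`, so dominated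
  -- convergence applies to them.
  obtain ⟨c, hc⟩ := (hconst.eventually_lt_const hε).exists
  have hc' : Tendsto (fun n => ∫⁻ z,
      ENNReal.ofReal ((max (-(c : ℝ)) (min c (m n (X n z))) - V z) ^ 2) ∂μ) atTop
      (𝓝 (∫⁻ z, ENNReal.ofReal ((max (-(c : ℝ)) (min c (V z)) - V z) ^ 2) ∂μ)) := by
    refine tendsto_lintegral_of_dominated_convergence
      (fun z => ENNReal.ofReal ((c + |V z|) ^ 2)) (fun n => ?_) (fun n => .of_forall fun z => ?_)
      (hfin c) ?_
    · exact ((((hclip c).measurable.comp ((h n).measurable.comp (hX n))).sub hVm).pow_const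
        2).ennreal_ofReal
    · refine ENNReal.ofReal_le_ofReal ?_
      rw [← sq_abs]
      refine pow_le_pow_left₀ (abs_nonneg _) ((abs_sub _ _).trans ?_) 2
      gcongr
      have : (0 : ℝ) ≤ c := c.cast_nonneg
      rw [abs_le]
      exact ⟨le_max_left _ _, max_le (by linarith) (min_le_left _ _)⟩
    · filter_upwards [hlim] with z hz
      have hcont : Continuous fun y : ℝ =>
        ENNReal.ofReal ((max (-(c : ℝ)) (min c y) - V z) ^ 2) :=
        ENNReal.continuous_ofReal.comp (((hclip c).sub continuous_const).pow 2)
      exact (hcont.tendsto _).comp hz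
  filter_upwards [hc'.eventually_lt_const hc] with n hn
  -- The clipped curve is a function of the same statistic, hence a competitor of `m n`.
  exact ((h n).lintegral_sq_sub_le (hX n) hVm hV
    ((hclip c).measurable.comp (h n).measurable)).trans hn.le

theorem tendsto_lintegral_abs_of_sq {d : ℕ → Z → ℝ}
    (hd : ∀ n, Measurable (d n))
    (h : Tendsto (fun n => ∫⁻ z, ENNReal.ofReal (d n z ^ 2) ∂μ) atTop (𝓝 0)) :
    Tendsto (fun n => ∫⁻ z, ENNReal.ofReal |d n z| ∂μ) atTop (𝓝 0) := by
  have hroot : Tendsto (fun n => (∫⁻ z, ENNReal.ofReal (d n z ^ 2) ∂μ) ^ (1 / 2 : ℝ)) atTop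
      (𝓝 0) := by
    simpa using h.ennrpow_const (1 / 2 : ℝ)
  refine tendsto_of_tendsto_of_tendsto_of_le_of_le tendsto_const_nhds hroot
    (fun _ => zero_le) fun n => ?_
  have hle := eLpNorm_le_eLpNorm_of_exponent_le (μ := μ) one_le_two (hd n).aestronglyMeasurable
  rw [eLpNorm_one_eq_lintegral_enorm,
    eLpNorm_eq_lintegral_rpow_enorm_toReal two_ne_zero ENNReal.ofNat_ne_top] at hle
  simpa [Real.enorm_eq_ofReal_abs, ← ENNReal.ofReal_pow] using hle

end Convergence

/-! ### Recovering the parameter from an infinite sample -/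

section Identification

variable {Θ E : Type*} [MeasurableSpace Θ] [MeasurableSpace E]

/-- For an identifiable family, the parameter is a measurable function of an infinite i.i.d.
sample. -/
theorem exists_measurable_sampleKernel_ae_eq [StandardBorelSpace Θ] [Nonempty Θ]
    [MeasurableSpace.CountablyGenerated E] (R : Kernel Θ E) [IsMarkovKernel R]
    (hinj : Function.Injective fun θ => R θ) :
    ∃ g : (ℕ → E) → Θ, Measurable g ∧ ∀ θ, ∀ᵐ x ∂(sampleKernel ℕ R θ), g x = θ := by
  -- Finite intersections of a countable generating sequence form a countable π-system, so the
  -- probabilities of these sets determine `R θ`, and by identifiability `θ`.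
  let A : Finset ℕ → Set E := fun s => ⋂ i ∈ s, MeasurableSpace.natGeneratingSequence E i
  have hA : ∀ s, MeasurableSet (A s) := fun s =>
    s.measurableSet_biInter fun i _ => MeasurableSpace.measurableSet_natGeneratingSequence i
  let φ : Θ → Finset ℕ → ℝ := fun θ s => (R θ).real (A s)
  have hφ : Measurable φ := measurable_pi_lambda _ fun s =>
    (R.measurable_coe (hA s)).ennreal_toReal
  have hφinj : Function.Injective φ := by
    intro θ θ' hθ
    refine hinj (ext_of_generate_finite (Set.range A) ?_ ?_ ?_ (by simp))
    · refine le_antisymm ?_ (MeasurableSpace.generateFrom_le ?_)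
      · rw [← MeasurableSpace.generateFrom_natGeneratingSequence E]
        refine MeasurableSpace.generateFrom_mono ?_
        rintro _ ⟨i, rfl⟩
        exact ⟨{i}, by simp [A]⟩
      · rintro _ ⟨s, rfl⟩
        exact hA s
    · rintro _ ⟨s, rfl⟩ _ ⟨t, rfl⟩ _
      exact ⟨s ∪ t, by ext x; simp [A, or_imp, forall_and]⟩
    · rintro _ ⟨s, rfl⟩
      exact (measureReal_eq_measureReal_iff).1 (congrFun hθ s)
  -- Lusin–Souslin: the injective Borel map `φ` is a measurable embedding, so it has a left inverse
  -- that is measurable on the whole space.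
  obtain ⟨ψ, hψ, hψφ⟩ := (hφ.measurableEmbedding hφinj).exists_measurable_extend measurable_id
    fun _ => inferInstance
  let avg : Finset ℕ → ℕ → (ℕ → E) → ℝ := fun s n x =>
    (∑ i ∈ Finset.range n, (A s).indicator (fun _ => (1 : ℝ)) (x i)) / n
  have hind : ∀ s, Measurable ((A s).indicator fun _ => (1 : ℝ)) := fun s =>
    measurable_const.indicator (hA s)
  have havg : ∀ s n, Measurable (avg s n) := fun s n =>
    (Finset.measurable_sum _ fun i _ => (hind s).comp (measurable_pi_apply i)).div_const _
  -- The `limsup` is measurable without any convergence assumption and equals the limit of the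
  -- empirical frequencies wherever the strong law holds.
  refine ⟨fun x => ψ fun s => limsup (fun n => avg s n x) atTop,
    hψ.comp (measurable_pi_lambda _ fun s => .limsup (havg s)), fun θ => ?_⟩
  have hlln : ∀ s, ∀ᵐ x ∂(sampleKernel ℕ R θ), Tendsto (fun n => avg s n x) atTop
      (𝓝 ((R θ).real (A s))) := by
    intro s
    have hid : ∀ i, (sampleKernel ℕ R θ).map (fun x => x i) = R θ := fun i =>
      Measure.infinitePi_map_eval (fun _ : ℕ => R θ) i
    have hindep : iIndepFun (fun i (x : ℕ → E) => (A s).indicator (fun _ => (1 : ℝ)) (x i))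
        (sampleKernel ℕ R θ) := iIndepFun_infinitePi fun _ => hind s
    have hmeas : ∀ i, Measurable fun x : ℕ → E => (A s).indicator (fun _ => (1 : ℝ)) (x i) :=
      fun i => (hind s).comp (measurable_pi_apply i)
    have := strong_law_ae_real (μ := sampleKernel ℕ R θ)
      (fun i x => (A s).indicator (fun _ => (1 : ℝ)) (x i))
      (Integrable.of_bound (hmeas 0).aestronglyMeasurable 1 (.of_forall fun x => by
        by_cases hx : x 0 ∈ A s <;> simp [hx]))
      (fun i j hij => hindep.indepFun hij)
      (fun i => ⟨(hmeas i).aemeasurable, (hmeas 0).aemeasurable, by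
        have hcomp := fun i => Measure.map_map (μ := sampleKernel ℕ R θ) (hind s)
          (measurable_pi_apply i)
        simp only [hid] at hcomp
        exact (hcomp i).symm.trans (hcomp 0)⟩)
    have hmean : ∫ x, (A s).indicator (fun _ => (1 : ℝ)) (x 0) ∂(sampleKernel ℕ R θ) =
        (R θ).real (A s) := by
      rw [← integral_map (φ := fun x : ℕ → E => x 0) (measurable_pi_apply 0).aemeasurable
        (hind s).aestronglyMeasurable, hid]
      exact integral_indicator_one (hA s)
    rwa [hmean] at this
  filter_upwards [ae_all_iff.2 hlln] with x hx
  rw [show (fun s => limsup (fun n => avg s n x) atTop) = φ θ from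
    funext fun s => (hx s).limsup_eq]
  exact congrFun hψφ θ

end Identification

end BayesRegression
namespace BayesRegression

theorem integrable_map_of_comp {Z W : Type*} [MeasurableSpace Z] [MeasurableSpace W] {μ : Measure Z}
    {T : Z → W} {g : W → ℝ} (hT : Measurable T) (hg : Measurable g)
    (h : Integrable (fun z => g (T z)) μ) : Integrable g (μ.map T) :=
  (integrable_map_measure hg.aestronglyMeasurable hT.aemeasurable).2 h

/-! ### Regression curves under the joint law -/

section Model

variable {Θ Ω₁ : Type*} [MeasurableSpace Θ] [MeasurableSpace Ω₁] {ι : Type*} {Q : Measure Θ}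
  {R : Kernel Θ (Ω₁ × ℝ)} [IsMarkovKernel R]

theorem memLp_two_jointLaw
    (hsq : ∫⁻ θ, ∫⁻ x, ENNReal.ofReal (x.2 ^ 2) ∂(R θ) ∂Q < ∞) :
    MemLp (fun z => z.2.1.2) 2 (jointLaw ι Q R) := by
  have hm : Measurable fun z : (ι → Ω₁ × ℝ) × (Ω₁ × ℝ) × Θ => z.2.1.2 := by fun_prop
  refine (memLp_two_iff_integrable_sq hm.aestronglyMeasurable).2
    ⟨(hm.pow_const 2).aestronglyMeasurable, ?_⟩
  rw [hasFiniteIntegral_iff_ofReal (.of_forall fun z => sq_nonneg _),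
    lintegral_jointLaw (hm.pow_const 2).ennreal_ofReal]
  simpa using hsq

variable [IsProbabilityMeasure Q]

theorem isRegressionCurve_jointLaw_sampling {r : Θ × Ω₁ → ℝ} (hr : Measurable r)
    (hint : Integrable (fun z => z.2.1.2) (jointLaw ι Q R))
    (h : ∀ᵐ θ ∂Q, IsRegressionCurve (R θ) Prod.fst Prod.snd fun x₁ => r (θ, x₁)) :
    IsRegressionCurve (jointLaw ι Q R) (fun z => ((z.1, z.2.2), z.2.1.1)) (fun z => z.2.1.2)
      (fun p => r (p.1.2, p.2)) := by
  have hT : Measurable fun z : (ι → Ω₁ × ℝ) × (Ω₁ × ℝ) × Θ => ((z.1, z.2.2), z.2.1) := by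
    fun_prop
  -- The parameter marginal is `Q`, so a property of `Q`-almost every `θ` holds for almost every
  -- pair `(x', θ)`.
  have hsnd : ((Q ⊗ₘ sampleKernel ι R).map Prod.swap).map Prod.snd = Q := by
    rw [Measure.map_map measurable_snd measurable_swap]
    exact Measure.fst_compProd Q (sampleKernel ι R)
  have := Measure.isProbabilityMeasure_map (μ := Q ⊗ₘ sampleKernel ι R) measurable_swap.aemeasurable
  refine (isRegressionCurve_map_iff (ν := jointLaw ι Q R) hT (X := fun w => (w.1, w.2.1))
    (Y := fun w => w.2.2) (by fun_prop) (by fun_prop)).1 ?_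
  have hint' := integrable_map_of_comp (T := fun z : (ι → Ω₁ × ℝ) × (Ω₁ × ℝ) × Θ =>
    ((z.1, z.2.2), z.2.1)) (g := fun w => w.2.2)
    (by fun_prop) (by fun_prop) hint
  rw [jointLaw_map_sample_param_obs] at hint' ⊢
  refine .compProd (by fun_prop) hint' ?_
  rw [← hsnd] at h
  exact ae_of_ae_map measurable_snd.aemeasurable h

theorem isRegressionCurve_jointLaw_predictive {n : ℕ} {post : Kernel (Fin n → Ω₁ × ℝ) Θ}
    {m : (Fin n → Ω₁ × ℝ) × Ω₁ → ℝ}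
    (hint : Integrable (fun z => z.2.1.2) (jointLaw (Fin n) Q R))
    (hpost : IsPosterior Q (sampleKernel (Fin n) R) post)
    (h : IsPredictiveRegressionCurve Q R post m) :
    IsRegressionCurve (jointLaw (Fin n) Q R) (fun z => (z.1, z.2.1.1)) (fun z => z.2.1.2) m := by
  have := hpost.isMarkovKernel
  have hT : Measurable fun z : (Fin n → Ω₁ × ℝ) × (Ω₁ × ℝ) × Θ => (z.1, z.2.1) := by fun_prop
  refine (isRegressionCurve_map_iff (ν := jointLaw (Fin n) Q R) hT (X := fun w => (w.1, w.2.1))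
    (Y := fun w => w.2.2) (by fun_prop) (by fun_prop)).1 ?_
  have hint' := integrable_map_of_comp (T := fun z : (Fin n → Ω₁ × ℝ) × (Ω₁ × ℝ) × Θ =>
    (z.1, z.2.1)) (g := fun w => w.2.2)
    (by fun_prop) (by fun_prop) hint
  rw [jointLaw_map_sample_obs hpost] at hint' ⊢
  refine .compProd h.measurable hint' (h.ae_isRegressionCurve.mono fun x' hx' => ?_)
  rwa [Kernel.comp_apply]

theorem exists_isPredictiveRegressionCurve [StandardBorelSpace Ω₁] {n : ℕ}
    {post : Kernel (Fin n → Ω₁ × ℝ) Θ}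
    (hint : Integrable (fun z => z.2.1.2) (jointLaw (Fin n) Q R))
    (hpost : IsPosterior Q (sampleKernel (Fin n) R) post) :
    ∃ m, IsPredictiveRegressionCurve Q R post m := by
  have := hpost.isMarkovKernel
  have hint' := integrable_map_of_comp (T := fun z : (Fin n → Ω₁ × ℝ) × (Ω₁ × ℝ) × Θ =>
    (z.1, z.2.1)) (g := fun w => w.2.2)
    (by fun_prop) (by fun_prop) hint
  rw [jointLaw_map_sample_obs hpost] at hint'
  refine ⟨fun p => ∫ y, y ∂((R ∘ₖ post).condKernel p), ?_, ?_⟩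
  · exact (measurable_snd.stronglyMeasurable.integral_kernel_prod_right'
      (κ := (R ∘ₖ post).condKernel) (f := fun p => p.2)).measurable
  -- Fubini: the second coordinate is integrable under the posterior predictive distribution of
  -- almost every sample.
  · filter_upwards [((Measure.integrable_compProd_iff hint'.1).1 hint').1] with x' hx'
    rw [← Kernel.comp_apply]
    exact isRegressionCurve_condKernel (R ∘ₖ post) hx'

theorem exists_isRegressionCurve_kernel [StandardBorelSpace Ω₁]
    [MeasurableSpace.CountableOrCountablyGenerated Θ Ω₁]
    (hint : Integrable (fun z => z.2.1.2) (jointLaw ι Q R)) :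
    ∃ r : Θ × Ω₁ → ℝ, Measurable r ∧
      ∀ᵐ θ ∂Q, IsRegressionCurve (R θ) Prod.fst Prod.snd fun x₁ => r (θ, x₁) := by
  have hint' := integrable_map_of_comp (T := fun z : (ι → Ω₁ × ℝ) × (Ω₁ × ℝ) × Θ =>
    (z.2.2, z.2.1)) (g := fun w => w.2.2)
    (by fun_prop) (by fun_prop) hint
  rw [jointLaw_map_param_obs] at hint'
  refine ⟨fun p => ∫ y, y ∂(R.condKernel p), ?_, ?_⟩
  · exact (measurable_snd.stronglyMeasurable.integral_kernel_prod_right'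
      (κ := R.condKernel) (f := fun p => p.2)).measurable
  · filter_upwards [((Measure.integrable_compProd_iff hint'.1).1 hint').1] with θ hθ
    exact isRegressionCurve_condKernel R hθ

theorem isRegressionCurve_jointLaw_of_sampling {n : ℕ} {post : Kernel (Fin n → Ω₁ × ℝ) Θ}
    {m : (Fin n → Ω₁ × ℝ) × Ω₁ → ℝ} {r : Θ × Ω₁ → ℝ} (hr : Measurable r)
    (hint : Integrable (fun z => z.2.1.2) (jointLaw (Fin n) Q R))
    (hR : ∀ᵐ θ ∂Q, IsRegressionCurve (R θ) Prod.fst Prod.snd fun x₁ => r (θ, x₁))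
    (hpost : IsPosterior Q (sampleKernel (Fin n) R) post)
    (h : IsPredictiveRegressionCurve Q R post m) :
    IsRegressionCurve (jointLaw (Fin n) Q R) (fun z => (z.1, z.2.1.1))
      (fun z => r (z.2.2, z.2.1.1)) m :=
  (isRegressionCurve_jointLaw_predictive hint hpost h).tower
    (X' := fun z => ((z.1, z.2.2), z.2.1.1)) (r' := fun p => r (p.1.2, p.2))
    (isRegressionCurve_jointLaw_sampling hr hint hR) (by fun_prop) (by fun_prop)
    (g := fun p : ((Fin n → Ω₁ × ℝ) × Θ) × Ω₁ => (p.1.1, p.2)) (by fun_prop) fun _ => rfl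

theorem isRegressionCurve_jointLaw_nat {n : ℕ} {m : (Fin n → Ω₁ × ℝ) × Ω₁ → ℝ}
    {r : Θ × Ω₁ → ℝ} (hr : Measurable r)
    (h : IsRegressionCurve (jointLaw (Fin n) Q R) (fun z => (z.1, z.2.1.1))
      (fun z => r (z.2.2, z.2.1.1)) m) :
    IsRegressionCurve (jointLaw ℕ Q R) (fun z => (fun i : Fin n => z.1 i, z.2.1.1))
      (fun z => r (z.2.2, z.2.1.1)) m := by
  rw [← jointLaw_map_precomp (R := R) (Q := Q) (Fin.val_injective (n := n))] at h
  exact (isRegressionCurve_map_iff (by fun_prop) (by fun_prop) (by fun_prop)).1 h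

/-- Doob's argument: replacing `θ` by its recovery `g x'` turns the response into a function of the
data in the limit. -/
theorem tendsto_ae_jointLaw [StandardBorelSpace Θ] [StandardBorelSpace Ω₁]
    (hinj : Function.Injective fun θ => R θ) {r : Θ × Ω₁ → ℝ} (hr : Measurable r)
    {m : ∀ n : ℕ, (Fin n → Ω₁ × ℝ) × Ω₁ → ℝ}
    (h : ∀ n : ℕ, IsRegressionCurve (jointLaw ℕ Q R)
      (fun z => (fun i : Fin n => z.1 i, z.2.1.1)) (fun z => r (z.2.2, z.2.1.1)) (m n)) :
    ∀ᵐ z ∂(jointLaw ℕ Q R), Tendsto (fun n : ℕ => m n (fun i : Fin n => z.1 i, z.2.1.1)) atTop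
      (𝓝 (r (z.2.2, z.2.1.1))) := by
  have : Nonempty Θ := nonempty_of_isProbabilityMeasure Q
  obtain ⟨g, hg, hgθ⟩ := exists_measurable_sampleKernel_ae_eq R hinj
  have hgz : ∀ᵐ z ∂(jointLaw ℕ Q R), g z.1 = z.2.2 := by
    have hae : ∀ᵐ p ∂(Q ⊗ₘ sampleKernel ℕ R), g p.2 = p.1 := by
      rw [Measure.ae_compProd_iff (measurableSet_eq_fun (by fun_prop) (by fun_prop))]
      exact .of_forall hgθ
    rw [← jointLaw_map_param_sample] at hae
    exact ae_of_ae_map (by fun_prop) hae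
  let 𝓕 : ℕ → MeasurableSpace ((ℕ → Ω₁ × ℝ) × (Ω₁ × ℝ) × Θ) := fun n =>
    MeasurableSpace.comap (fun z => (fun i : Fin n => z.1 i, z.2.1.1)) inferInstance
  have hstat : ∀ n, Measurable[𝓕 n] fun z : (ℕ → Ω₁ × ℝ) × (Ω₁ × ℝ) × Θ =>
      (fun i : Fin n => z.1 i, z.2.1.1) := fun n => comap_measurable _
  have hmono : Monotone 𝓕 := by
    intro k n hkn
    have : Measurable fun q : (Fin n → Ω₁ × ℝ) × Ω₁ =>
        (fun i : Fin k => q.1 (Fin.castLE hkn i), q.2) := by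
      fun_prop
    exact (this.comp (hstat n)).comap_le
  have hsample : Measurable[⨆ n, 𝓕 n] fun z : (ℕ → Ω₁ × ℝ) × (Ω₁ × ℝ) × Θ => z.1 :=
    -- Coordinate `i`, counted from zero, is the last entry of the sample of size `i + 1`.
    @measurable_pi_lambda _ _ _ (⨆ n, 𝓕 n) _ _ fun i =>
      ((measurable_pi_apply (Fin.last i)).comp (measurable_fst.comp (hstat (i + 1)))).mono
        (le_iSup 𝓕 (i + 1)) le_rfl
  have hx₁ : Measurable[⨆ n, 𝓕 n] fun z : (ℕ → Ω₁ × ℝ) × (Ω₁ × ℝ) × Θ => z.2.1.1 :=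
    (measurable_snd.comp (hstat 0)).mono (le_iSup 𝓕 0) le_rfl
  refine tendsto_ae_of_isRegressionCurve (fun n => by fun_prop) hmono h
    (W := fun z => r (g z.1, z.2.1.1))
    (hr.comp ((hg.comp hsample).prodMk hx₁)).stronglyMeasurable ?_
  filter_upwards [hgz] with z hz
  rw [hz]

end Model

end BayesRegression

/-! ### The main theorem -/

open BayesRegression

theorem theorem1
    -- the parameter space: a Borel subset of a Polish space with its Borel σ-algebra, and a prior
    {S : Type*} [TopologicalSpace S] [PolishSpace S] [MeasurableSpace S] [BorelSpace S]
    {Θ : Set S} (hΘ : MeasurableSet Θ) (Q : Measure Θ) [IsProbabilityMeasure Q]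
    -- the statistical experiment and the two statistics
    {Ω : Type*} [MeasurableSpace Ω] (P : Θ → Measure Ω) [∀ θ, IsProbabilityMeasure (P θ)]
    {Ω₁ : Type*} [MeasurableSpace Ω₁] [StandardBorelSpace Ω₁]
    (X₁ : Ω → Ω₁) (hX₁ : Measurable X₁) (X₂ : Ω → ℝ) (hX₂ : Measurable X₂)
    -- the joint distributions `R_θ` of `(X₁, X₂)` form an identifiable Markov kernel
    (R : Kernel Θ (Ω₁ × ℝ)) [IsMarkovKernel R]
    (hR : ∀ θ, R θ = (P θ).map fun ω => (X₁ ω, X₂ ω))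
    (hident : Function.Injective fun θ => R θ)
    -- `E_θ(X₂²)` has finite prior mean
    (hsq : ∫⁻ θ, ∫⁻ ω, ENNReal.ofReal (X₂ ω ^ 2) ∂(P θ) ∂Q < ∞) :
    -- the objects below exist
    (∃ r, BayesRegression.IsSamplingRegressionCurve Q P X₁ X₂ r) ∧
    (∀ n : ℕ, ∃ post,
      BayesRegression.IsPosterior Q (BayesRegression.sampleKernel (Fin n) R) post) ∧
    (∀ (n : ℕ) (post : Kernel (Fin n → Ω₁ × ℝ) Θ),
      BayesRegression.IsPosterior Q (BayesRegression.sampleKernel (Fin n) R) post →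
      ∃ m, BayesRegression.IsPredictiveRegressionCurve Q R post m) ∧
    -- and, for all versions of them,
    ∀ (r : Θ × Ω₁ → ℝ) (post : ∀ n : ℕ, Kernel (Fin n → Ω₁ × ℝ) Θ)
      (m : ∀ n : ℕ, (Fin n → Ω₁ × ℝ) × Ω₁ → ℝ),
      BayesRegression.IsSamplingRegressionCurve Q P X₁ X₂ r →
      (∀ n, BayesRegression.IsPosterior Q (BayesRegression.sampleKernel (Fin n) R) (post n)) →
      (∀ n, BayesRegression.IsPredictiveRegressionCurve Q R (post n) (m n)) →
      -- (i) `m n` minimizes the Bayes risk for the squared error among all estimators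
      (∀ (n : ℕ) (m' : (Fin n → Ω₁ × ℝ) × Ω₁ → ℝ), Measurable m' →
        ∫⁻ z, ENNReal.ofReal ((m n (z.1, z.2.1.1) - r (z.2.2, z.2.1.1)) ^ 2)
            ∂(BayesRegression.jointLaw (Fin n) Q R) ≤
          ∫⁻ z, ENNReal.ofReal ((m' (z.1, z.2.1.1) - r (z.2.2, z.2.1.1)) ^ 2)
            ∂(BayesRegression.jointLaw (Fin n) Q R)) ∧
      -- (ii) strong consistency
      (∀ᵐ z ∂(BayesRegression.jointLaw ℕ Q R),
        Tendsto (fun n : ℕ => m n (fun i : Fin n => z.1 i, z.2.1.1)) atTop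
          (𝓝 (r (z.2.2, z.2.1.1)))) ∧
      -- (iii) the Bayes risks for the absolute and for the squared error tend to zero
      (∀ k : ℕ, k = 1 ∨ k = 2 →
        Tendsto (fun n : ℕ => ∫⁻ z, ENNReal.ofReal
            (|m n (fun i : Fin n => z.1 i, z.2.1.1) - r (z.2.2, z.2.1.1)| ^ k)
            ∂(BayesRegression.jointLaw ℕ Q R)) atTop (𝓝 0)) := by
  have : StandardBorelSpace Θ := hΘ.standardBorel
  have : Nonempty Θ := nonempty_of_isProbabilityMeasure Q
  have hpair : Measurable fun ω => (X₁ ω, X₂ ω) := hX₁.prodMk hX₂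
  have hsqR : ∫⁻ θ, ∫⁻ x, ENNReal.ofReal (x.2 ^ 2) ∂(R θ) ∂Q < ∞ := by
    refine lt_of_eq_of_lt (lintegral_congr fun θ => ?_) hsq
    rw [hR θ, lintegral_map (by fun_prop) hpair]
  have hcurve : ∀ (θ : Θ) (f : Ω₁ → ℝ),
      IsRegressionCurve (R θ) Prod.fst Prod.snd f ↔ IsRegressionCurve (P θ) X₁ X₂ f := by
    intro θ f
    rw [hR θ]
    exact isRegressionCurve_map_iff hpair measurable_fst measurable_snd
  have hint : ∀ n, Integrable (fun z => z.2.1.2) (jointLaw (Fin n) Q R) := fun n =>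
    (memLp_two_jointLaw hsqR).integrable one_le_two
  refine ⟨?_, fun n => ⟨_, isPosterior_posterior _⟩,
    fun n post hpost => exists_isPredictiveRegressionCurve (hint n) hpost, ?_⟩
  -- The sample plays no role for the sampling curve, so the empty one serves.
  · obtain ⟨r, hr, hrR⟩ := exists_isRegressionCurve_kernel (hint 0)
    exact ⟨r, hr, hrR.mono fun θ hθ => (hcurve θ _).1 hθ⟩
  intro r post m hr hpost hm
  have hrm := hr.measurable
  have hrR : ∀ᵐ θ ∂Q, IsRegressionCurve (R θ) Prod.fst Prod.snd fun x₁ => r (θ, x₁) :=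
    hr.ae_isRegressionCurve.mono fun θ hθ => (hcurve θ _).2 hθ
  have hfin := fun n => isRegressionCurve_jointLaw_of_sampling hrm (hint n) hrR (hpost n) (hm n)
  have hnat := fun n => isRegressionCurve_jointLaw_nat hrm (hfin n)
  have hL2 : ∀ ι : Type, MemLp (fun z => r (z.2.2, z.2.1.1)) 2 (jointLaw ι Q R) := fun ι =>
    (isRegressionCurve_jointLaw_sampling hrm
      ((memLp_two_jointLaw hsqR).integrable one_le_two) hrR).memLp_two (memLp_two_jointLaw hsqR)
  have hlim := tendsto_ae_jointLaw hident hrm hnat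
  have hrisk := tendsto_lintegral_sq_sub_of_isRegressionCurve (fun n => by fun_prop) hnat
    (by fun_prop) (hL2 ℕ) hlim
  refine ⟨fun n m' hm' => (hfin n).lintegral_sq_sub_le (by fun_prop) (by fun_prop) (hL2 _) hm',
    hlim, ?_⟩
  rintro k (rfl | rfl)
  · simp only [pow_one]
    refine tendsto_lintegral_abs_of_sq (fun n => ?_) hrisk
    exact ((hm n).measurable.comp (by fun_prop)).sub (by fun_prop)
  · simpa only [sq_abs] using hrisk
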